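/- Let $\mathbb{D}=\mathbb{Z}[1/2]\subset\mathbb{R}$ be the ring of dyadic rationals, and equip $\mathbb{D}^n\subset\mathbb{R}^n$ with the operation $x\circ y=\tfrac12(x+y)$. A subgroupoid of $(\mathbb{D}^n,\circ)$ is a (possibly empty) subset closed under $\circ$. A real polytope is the convex hull of a finite set of points of $\mathbb{R}^m$. A dyadic polytope in $\mathbb{D}^m$ (of any dimension at most $m$) is a set $C=Q\cap\mathbb{D}^m$, where $Q\subset\mathbb{R}^m$ is a real polytope all of whose vertices lie in $\mathbb{D}^m$. A vertex of a subgroupoid $E$ of $(\mathbb{D}^m,\circ)$ is a point $v\in E$ such that $\{v\}$ is a wall of $E$, i.e. for all $a,b\in E$ one has $a\circ b=v$ if and only if $a=v$ and $b=v$. The relative interior $\mathrm{int}(C)$ of a dyadic polytope $C$ is the intersection of the affine $\mathbb{D}$-hull of $C$ with the relative interior of the real convex hull of $C$. A semipolytope in $\mathbb{D}^m$ is a subgroupoid $S$ of a dyadic polytope $C$ in $\mathbb{D}^m$ such that $S$ and $C$ have the same vertices and $S\cap\mathrm{int}(C)=\mathrm{int}(C)$. Theorem. Let $n\ge 0$ and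 let $D$ be a subgroupoid of $(\mathbb{D}^n,\circ)$. Then the groupoid $(D,\circ)$ is finitely generated if and only if there are an integer $m\ge 0$ and a semipolytope $S$ in $\mathbb{D}^m$ such that $(D,\circ)$ and $(S,\circ)$ are isomorphic groupoids. -/

import Mathlib

namespace DyadicConvex

/-- The ring `ℤ[1/2]` of dyadic rationals, as a subring of `ℝ`. -/
def dyadicRing : Subring ℝ where
  carrier := {x | ∃ (a : ℤ) (k : ℕ), x = (a : ℝ) / 2 ^ k}
  mul_mem' := by
    rintro _ _ ⟨a, k, rfl⟩ ⟨b, l, rfl⟩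
    exact ⟨a * b, k + l, by push_cast; rw [pow_add, div_mul_div_comm]⟩
  one_mem' := ⟨1, 0, by simp⟩
  add_mem' := by
    rintro _ _ ⟨a, k, rfl⟩ ⟨b, l, rfl⟩
    exact ⟨a * 2 ^ l + b * 2 ^ k, k + l, by push_cast; rw [pow_add]; field_simp⟩
  zero_mem' := ⟨0, 0, by simp⟩
  neg_mem' := by
    rintro _ ⟨a, k, rfl⟩
    exact ⟨-a, k, by push_cast; ring⟩

/-- The dyadic space `𝔻ⁿ`, as a subset of `ℝⁿ`. -/
def dyadicSpace (n : ℕ) : Set (Fin n → ℝ) := {x | ∀ i, x i ∈ dyadicRing}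

/-- The groupoid operation `x ∘ y = (x + y) / 2`. -/
noncomputable def mean {n : ℕ} (x y : Fin n → ℝ) : Fin n → ℝ := (1 / 2 : ℝ) • (x + y)

/-- `D` is a subgroupoid of `(𝔻ⁿ, ∘)` (the empty one is allowed). -/
def IsSubgroupoid {n : ℕ} (D : Set (Fin n → ℝ)) : Prop :=
  D ⊆ dyadicSpace n ∧ ∀ x ∈ D, ∀ y ∈ D, mean x y ∈ D

/-- The subgroupoid of `(𝔻ⁿ, ∘)` generated by a subset `X` of `𝔻ⁿ`. -/
def generated {n : ℕ} (X : Set (Fin n → ℝ)) : Set (Fin n → ℝ) :=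
  ⋂₀ {E | IsSubgroupoid E ∧ X ⊆ E}

/-- `D` is finitely generated as a groupoid. -/
def IsFinitelyGenerated {n : ℕ} (D : Set (Fin n → ℝ)) : Prop :=
  ∃ X : Set (Fin n → ℝ), X.Finite ∧ X ⊆ D ∧ generated X = D

/-- The subgroupoids `D` of `𝔻ᵐ` and `E` of `𝔻ⁿ` are isomorphic as groupoids. -/
def Isomorphic {m n : ℕ} (D : Set (Fin m → ℝ)) (E : Set (Fin n → ℝ)) : Prop :=
  ∃ e : D ≃ E, ∀ x y z : D, (z : Fin m → ℝ) = mean (x : Fin m → ℝ) (y : Fin m → ℝ) →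
    (e z : Fin n → ℝ) = mean (e x : Fin n → ℝ) (e y : Fin n → ℝ)

/-- A real polytope: the convex hull of a finite set of points of `ℝⁿ`. -/
def IsRealPolytope {n : ℕ} (Q : Set (Fin n → ℝ)) : Prop :=
  ∃ V : Set (Fin n → ℝ), V.Finite ∧ Q = convexHull ℝ V

/-- A dyadic polytope (of any dimension `≤ n`) in `𝔻ⁿ`: the intersection with `𝔻ⁿ` of a real
polytope all of whose vertices lie in `𝔻ⁿ`. -/
def IsDyadicPolytope {n : ℕ} (P : Set (Fin n → ℝ)) : Prop :=
  ∃ Q : Set (Fin n → ℝ), IsRealPolytope Q ∧ Q.extremePoints ℝ ⊆ dyadicSpace n ∧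
    P = Q ∩ dyadicSpace n

/-- `W` is a wall of `(D, ∘)`. -/
def IsWall {n : ℕ} (D W : Set (Fin n → ℝ)) : Prop :=
  W ⊆ D ∧ ∀ a ∈ D, ∀ b ∈ D, mean a b ∈ W ↔ a ∈ W ∧ b ∈ W

/-- The vertices of `(D, ∘)`: the points that form a (zero-dimensional) wall of `D`. -/
def vertices {n : ℕ} (D : Set (Fin n → ℝ)) : Set (Fin n → ℝ) :=
  {v | IsWall D {v}}

/-- The relative interior of a subset `C` of `𝔻ⁿ`: the intersection of the affine `𝔻`-hull of
`C` with the relative interior of the convex `ℝ`-hull of `C`. -/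
def relInterior {n : ℕ} (C : Set (Fin n → ℝ)) : Set (Fin n → ℝ) :=
  (affineSpan dyadicRing C : Set (Fin n → ℝ)) ∩ intrinsicInterior ℝ (convexHull ℝ C)

/-- `S` is a semipolytope in `𝔻ⁿ`: a subgroupoid of a dyadic polytope `C` that has the same
vertices as `C` and contains all relative interior points of `C`. -/
def IsSemipolytope {n : ℕ} (S : Set (Fin n → ℝ)) : Prop :=
  IsSubgroupoid S ∧ ∃ C : Set (Fin n → ℝ), IsDyadicPolytope C ∧ S ⊆ C ∧
    vertices C = vertices S ∧ S ∩ relInterior C = relInterior C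

end DyadicConvex

namespace DyadicConvex

/-! The key fact is `IsSubgroupoid.mem_of_isPosComb`: a point that is both a dyadic affine and a
strictly positive real convex combination of the same points of a subgroupoid lies in it. The two
coefficient vectors differ by a solution of a homogeneous system with dyadic coefficients. Dyadic
solutions are dense among real ones, so the dyadic coefficients can be corrected to positive ones,
and the point becomes an average of `2 ^ k` points.

A semipolytope lies in the hull of its finitely many vertices. Sort its points by the vertices used
with positive weight. As `ℤ[1/2]` is noetherian, finitely many points of each class span the class
affinely. Given small weights, they join those vertices in a family to which the key fact applies,
so these points and the vertices generate.

Conversely, coordinates are chosen in which the generators span `𝔻ᵐ` affinely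
(`exists_dyadic_coordinates`). The key fact then yields every relative interior point of their hull,
and vertices coincide with extreme points (`vertices_eq_extremePoints`). -/

/-! ### Dyadic approximation of solutions of linear systems -/

theorem exists_common_denominator {ι : Type*} [Fintype ι] (d : ι → ℝ)
    (hd : ∀ i, d i ∈ dyadicRing) : ∃ (k : ℕ) (n : ι → ℤ), ∀ i, d i = (n i : ℝ) / 2 ^ k := by
  choose a l h using hd
  refine ⟨∑ i, l i, fun i => a i * 2 ^ (∑ j, l j - l i), fun i => ?_⟩
  have hle : l i ≤ ∑ j, l j := Finset.single_le_sum (fun _ _ => Nat.zero_le _) (Finset.mem_univ i)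
  obtain ⟨e, he⟩ := Nat.exists_eq_add_of_le hle
  simp only [h i, he, Nat.add_sub_cancel_left]
  push_cast
  rw [pow_add]
  field_simp

theorem exists_dyadic_near (r : ℝ) {ε : ℝ} (hε : 0 < ε) : ∃ d ∈ dyadicRing, |d - r| < ε := by
  obtain ⟨k, hk⟩ := exists_pow_lt_of_lt_one hε (by norm_num : (1 / 2 : ℝ) < 1)
  refine ⟨(⌊r * 2 ^ k⌋ : ℝ) / 2 ^ k, ⟨_, _, rfl⟩, ?_⟩
  have h2 : (0 : ℝ) < 2 ^ k := by positivity
  have h1 := Int.floor_le (r * 2 ^ k)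
  have h3 := Int.lt_floor_add_one (r * 2 ^ k)
  have h4 : (⌊r * 2 ^ k⌋ : ℝ) / 2 ^ k ≤ r := by rwa [div_le_iff₀ h2]
  have h5 : r - (1 / 2) ^ k < (⌊r * 2 ^ k⌋ : ℝ) / 2 ^ k := by
    rw [lt_div_iff₀ h2, sub_mul, ← mul_pow]
    norm_num
  rw [abs_lt]
  constructor <;> linarith

theorem intCast_mem_dyadicRing (a : ℤ) : (a : ℝ) ∈ dyadicRing := ⟨a, 0, by simp⟩

theorem half_mem_dyadicRing : (1 / 2 : ℝ) ∈ dyadicRing := ⟨1, 1, by norm_num⟩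

/-- Linear independence over `ℤ` implies linear independence over the dyadic rationals. -/
theorem eq_zero_of_sum_dyadic_smul_eq_zero {J E : Type*} [Fintype J] [AddCommGroup E] [Module ℝ E]
    {r : J → E} (hr : LinearIndependent ℤ r) {d : J → ℝ} (hd : ∀ j, d j ∈ dyadicRing)
    (h : ∑ j, d j • r j = 0) (j : J) : d j = 0 := by
  obtain ⟨k, n, hn⟩ := exists_common_denominator d hd
  have h0 : ∑ j, n j • r j = 0 := by
    have : ∑ j, n j • r j = (2 : ℝ) ^ k • ∑ j, d j • r j := by
      rw [Finset.smul_sum]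
      refine Finset.sum_congr rfl fun j _ => ?_
      rw [hn, smul_smul, mul_div_cancel₀ _ (by positivity), Int.cast_smul_eq_zsmul]
    rw [this, h, smul_zero]
  rw [hn, Fintype.linearIndependent_iff.1 hr n h0 j]
  simp

/-- The dyadic solutions of a homogeneous linear system with dyadic coefficients are dense in the
space of real solutions. -/
theorem exists_dyadic_solution_near {ι κ : Type*} [Fintype ι] {y : ι → κ → ℝ}
    (hy : ∀ i l, y i l ∈ dyadicRing) {z : ι → ℝ} (hz : ∑ i, z i • y i = 0) {ε : ℝ} (hε : 0 < ε) :
    ∃ z' : ι → ℝ, (∀ i, z' i ∈ dyadicRing) ∧ (∀ i, |z' i - z i| < ε) ∧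
      ∑ i, z' i • y i = 0 := by
  -- Write `z` in a `ℤ`-basis `b` of the group generated by its entries. Independence of `b` over
  -- the dyadics makes each integer vector `v · j` a solution, so replacing `b j` by a nearby dyadic
  -- `r j` preserves the equation.
  let N := Submodule.span ℤ (Set.range z)
  have : Module.Finite ℤ N := Module.Finite.span_of_finite ℤ (Set.finite_range z)
  let b := Module.Free.chooseBasis ℤ N
  let v : ι → Module.Free.ChooseBasisIndex ℤ N → ℤ :=
    fun i j => b.repr ⟨z i, Submodule.subset_span ⟨i, rfl⟩⟩ j
  have hv : ∀ i, z i = ∑ j, (v i j : ℝ) * (b j : ℝ) := by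
    intro i
    have := congrArg N.subtype (b.sum_repr ⟨z i, Submodule.subset_span ⟨i, rfl⟩⟩)
    simp only [map_sum, map_smul, Submodule.subtype_apply, zsmul_eq_mul] at this
    exact this.symm
  have hb : LinearIndependent ℤ (fun j => (b j : ℝ)) :=
    b.linearIndependent.map' N.subtype (Submodule.ker_subtype N)
  have hker : ∀ j l, ∑ i, (v i j : ℝ) * y i l = 0 := by
    intro j l
    refine eq_zero_of_sum_dyadic_smul_eq_zero hb (d := fun j => ∑ i, (v i j : ℝ) * y i l)
      (fun j => sum_mem fun i _ => mul_mem (intCast_mem_dyadicRing _) (hy i l)) ?_ j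
    have h := congrFun hz l
    simp only [Finset.sum_apply, Pi.smul_apply, smul_eq_mul, Pi.zero_apply] at h
    simp only [smul_eq_mul, Finset.sum_mul]
    rw [Finset.sum_comm, ← h]
    refine Finset.sum_congr rfl fun i _ => ?_
    rw [hv i, Finset.sum_mul]
    exact Finset.sum_congr rfl fun j _ => by ring
  set M : ℝ := ∑ i, ∑ j, |(v i j : ℝ)| with hM
  have hM0 : 0 ≤ M := by positivity
  choose r hr hrb using fun j => exists_dyadic_near (b j : ℝ) (div_pos hε (by linarith : 0 < M + 1))
  refine ⟨fun i => ∑ j, (v i j : ℝ) * r j,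
    fun i => sum_mem fun j _ => mul_mem (intCast_mem_dyadicRing _) (hr j), fun i => ?_, ?_⟩
  · have h1 : ∑ j, |(v i j : ℝ)| ≤ M :=
      Finset.single_le_sum (f := fun i => ∑ j, |(v i j : ℝ)|) (fun _ _ => by positivity)
        (Finset.mem_univ i)
    calc |∑ j, (v i j : ℝ) * r j - z i| = |∑ j, (v i j : ℝ) * (r j - b j)| := by
          rw [hv i, ← Finset.sum_sub_distrib]
          simp only [mul_sub]
      _ ≤ ∑ j, |(v i j : ℝ)| * (ε / (M + 1)) := by
          refine (Finset.abs_sum_le_sum_abs _ _).trans (Finset.sum_le_sum fun j _ => ?_)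
          rw [abs_mul]
          exact mul_le_mul_of_nonneg_left (hrb j).le (abs_nonneg _)
      _ ≤ M * (ε / (M + 1)) := by
          rw [← Finset.sum_mul]
          exact mul_le_mul_of_nonneg_right h1 (by positivity)
      _ < ε := by
          rw [← mul_div_assoc, div_lt_iff₀ (by linarith)]
          nlinarith
  · ext l
    simp only [Finset.sum_apply, Pi.smul_apply, smul_eq_mul, Pi.zero_apply, Finset.sum_mul]
    rw [Finset.sum_comm]
    refine Finset.sum_eq_zero fun j _ => ?_
    rw [← mul_zero (r j), ← hker j l, Finset.mul_sum]
    exact Finset.sum_congr rfl fun i _ => by ring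

/-! ### Positive and dyadic affine combinations -/

/-- `p` is a convex combination of the family `x` with all coefficients positive. -/
def IsPosComb {ι E : Type*} [Fintype ι] [AddCommGroup E] [Module ℝ E] (x : ι → E) (p : E) : Prop :=
  ∃ c : ι → ℝ, (∀ i, 0 < c i) ∧ ∑ i, c i = 1 ∧ ∑ i, c i • x i = p

/-- `p` is an affine combination of the family `x` with dyadic coefficients. -/
def IsDyadicAffineComb {ι E : Type*} [Fintype ι] [AddCommGroup E] [Module ℝ E] (x : ι → E)
    (p : E) : Prop :=
  ∃ c : ι → ℝ, (∀ i, c i ∈ dyadicRing) ∧ ∑ i, c i = 1 ∧ ∑ i, c i • x i = p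

theorem exists_pos_le {ι : Type*} [Finite ι] (c : ι → ℝ) (hc : ∀ i, 0 < c i) :
    ∃ ε > 0, ∀ i, ε ≤ c i := by
  cases isEmpty_or_nonempty ι
  · exact ⟨1, one_pos, fun i => isEmptyElim i⟩
  · obtain ⟨i, hi⟩ := Finite.exists_min c
    exact ⟨c i, hc i, hi⟩

/-- A dyadic affine combination that is also a positive real convex combination is a positive
dyadic convex combination. -/
theorem IsPosComb.exists_nat {ι : Type*} [Fintype ι] {m : ℕ} {x : ι → Fin m → ℝ} {p : Fin m → ℝ}
    (hx : ∀ i, x i ∈ dyadicSpace m) (h : IsPosComb x p) (h' : IsDyadicAffineComb x p) :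
    ∃ (k : ℕ) (n : ι → ℕ), (∀ i, 0 < n i) ∧ ∑ i, n i = 2 ^ k ∧
      (1 / 2 ^ k : ℝ) • ∑ i, n i • x i = p := by
  obtain ⟨c, hc, hc1, hcp⟩ := h
  obtain ⟨b, hb, hb1, hbp⟩ := h'
  obtain ⟨ε, hε, hεc⟩ := exists_pos_le c hc
  -- The extra coordinate `1` encodes that the correction has coefficient sum zero.
  let y : ι → Option (Fin m) → ℝ := fun i o => o.elim 1 (x i)
  obtain ⟨z, hz, hzc, hz0⟩ := exists_dyadic_solution_near (y := y) (z := fun i => c i - b i)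
    (by
      rintro i (_ | l)
      · exact one_mem _
      · exact hx i l)
    (by
      ext o
      rcases o with _ | l
      · simp [y, hc1, hb1]
      · have h1 := congrFun hcp l
        have h2 := congrFun hbp l
        simp only [Finset.sum_apply, Pi.smul_apply, smul_eq_mul] at h1 h2
        simp [y, sub_mul, h1, h2]) hε
  have hpos : ∀ i, 0 < b i + z i := by
    intro i
    have := (abs_lt.1 (hzc i)).1
    linarith [hεc i]
  obtain ⟨k, n, hn⟩ := exists_common_denominator (fun i => b i + z i)
    (fun i => add_mem (hb i) (hz i))
  have h2 : (0 : ℝ) < 2 ^ k := by positivity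
  have hn0 : ∀ i, 0 < n i := by
    intro i
    have := hpos i
    simp only [hn i] at this
    rw [lt_div_iff₀ h2, zero_mul] at this
    exact_mod_cast this
  have hcast : ∀ i, (((n i).toNat : ℕ) : ℝ) = 2 ^ k * (b i + z i) := by
    intro i
    rw [show (((n i).toNat : ℕ) : ℝ) = (((n i).toNat : ℤ) : ℝ) by norm_cast,
      Int.toNat_of_nonneg (hn0 i).le, hn i]
    field_simp
  refine ⟨k, fun i => (n i).toNat, fun i => Int.lt_toNat.2 (hn0 i), ?_, ?_⟩
  · have hs : ∑ i, z i = 0 := by simpa [y] using congrFun hz0 none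
    have : ((∑ i, (n i).toNat : ℕ) : ℝ) = 2 ^ k := by
      push_cast
      rw [Finset.sum_congr rfl fun i _ => hcast i, ← Finset.mul_sum, Finset.sum_add_distrib, hb1,
        hs, add_zero, mul_one]
    exact_mod_cast this
  · have hs : ∑ i, z i • x i = 0 := by
      ext l
      simpa [y] using congrFun hz0 (some l)
    have : ∀ i, (n i).toNat • x i = (2 : ℝ) ^ k • ((b i + z i) • x i) := by
      intro i
      rw [smul_smul, ← hcast, Nat.cast_smul_eq_nsmul]
    rw [Finset.sum_congr rfl fun i _ => this i, ← Finset.smul_sum, smul_smul,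
      one_div_mul_cancel h2.ne', one_smul]
    simp only [add_smul, Finset.sum_add_distrib, hbp, hs, add_zero]

/-! ### Averages of `2 ^ k` points, and vertices -/

theorem two_inv_pow_mean {n : ℕ} (k : ℕ) (x y : Fin n → ℝ) :
    (1 / 2 ^ (k + 1) : ℝ) • (x + y) = mean ((1 / 2 ^ k : ℝ) • x) ((1 / 2 ^ k : ℝ) • y) := by
  rw [mean, ← smul_add, smul_smul, pow_succ]
  congr 1
  field_simp

theorem IsSubgroupoid.average_mem {n : ℕ} {S : Set (Fin n → ℝ)} (hS : IsSubgroupoid S) (k : ℕ) :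
    ∀ l : List (Fin n → ℝ), l.length = 2 ^ k → (∀ x ∈ l, x ∈ S) →
      (1 / 2 ^ k : ℝ) • l.sum ∈ S := by
  induction k with
  | zero =>
    intro l hl h
    obtain ⟨a, rfl⟩ := List.length_eq_one_iff.1 (by simpa using hl)
    simpa using h
  | succ k ih =>
    intro l hl h
    rw [← List.take_append_drop (2 ^ k) l, List.sum_append, two_inv_pow_mean]
    refine hS.2 _ (ih _ ?_ fun x hx => h x (List.mem_of_mem_take hx))
      _ (ih _ ?_ fun x hx => h x (List.mem_of_mem_drop hx))
    · rw [List.length_take, hl, pow_succ]; omega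
    · rw [List.length_drop, hl, pow_succ]; omega

theorem eq_of_average_eq_vertex {n : ℕ} {S : Set (Fin n → ℝ)} (hS : IsSubgroupoid S)
    {v : Fin n → ℝ} (hv : v ∈ vertices S) (k : ℕ) :
    ∀ l : List (Fin n → ℝ), l.length = 2 ^ k → (∀ x ∈ l, x ∈ S) →
      (1 / 2 ^ k : ℝ) • l.sum = v → ∀ x ∈ l, x = v := by
  induction k with
  | zero =>
    intro l hl h
    obtain ⟨a, rfl⟩ := List.length_eq_one_iff.1 (by simpa using hl)
    simp
  | succ k ih =>
    intro l hl h hlv x hx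
    have hl1 : (l.take (2 ^ k)).length = 2 ^ k := by rw [List.length_take, hl, pow_succ]; omega
    have hl2 : (l.drop (2 ^ k)).length = 2 ^ k := by rw [List.length_drop, hl, pow_succ]; omega
    have h1 : ∀ x ∈ l.take (2 ^ k), x ∈ S := fun x hx => h x (List.mem_of_mem_take hx)
    have h2 : ∀ x ∈ l.drop (2 ^ k), x ∈ S := fun x hx => h x (List.mem_of_mem_drop hx)
    rw [← List.take_append_drop (2 ^ k) l, List.sum_append, two_inv_pow_mean] at hlv
    obtain ⟨h3, h4⟩ := (hv.2 _ (hS.average_mem k _ hl1 h1) _ (hS.average_mem k _ hl2 h2)).1 hlv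
    rw [← List.take_append_drop (2 ^ k) l, List.mem_append] at hx
    exact hx.elim (ih _ hl1 h1 h3 x) (ih _ hl2 h2 h4 x)

theorem exists_list_of_multiplicities {ι E : Type*} [Fintype ι] [AddCommMonoid E] (x : ι → E)
    (n : ι → ℕ) : ∃ l : List E, l.length = ∑ i, n i ∧ l.sum = ∑ i, n i • x i ∧
      ∀ y, y ∈ l ↔ ∃ i, 0 < n i ∧ y = x i := by
  refine ⟨(∑ i, n i • ({x i} : Multiset E)).toList, ?_, ?_, fun y => ?_⟩
  · rw [Multiset.length_toList, Multiset.card_sum]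
    simp
  · rw [Multiset.sum_toList]
    change Multiset.sumAddMonoidHom _ = _
    rw [map_sum]
    exact Finset.sum_congr rfl fun i _ => by
      rw [Multiset.coe_sumAddMonoidHom, Multiset.sum_nsmul, Multiset.sum_singleton]
  · rw [Multiset.mem_toList, Multiset.mem_sum]
    simp [Multiset.mem_nsmul, Nat.pos_iff_ne_zero]

theorem IsSubgroupoid.mem_of_isPosComb {ι : Type*} [Fintype ι] {m : ℕ} {S : Set (Fin m → ℝ)}
    (hS : IsSubgroupoid S) {x : ι → Fin m → ℝ} {p : Fin m → ℝ} (hx : ∀ i, x i ∈ S)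
    (h : IsPosComb x p) (h' : IsDyadicAffineComb x p) : p ∈ S := by
  obtain ⟨k, n, -, hn, rfl⟩ := h.exists_nat (fun i => hS.1 (hx i)) h'
  obtain ⟨l, h1, h2, h3⟩ := exists_list_of_multiplicities x n
  rw [← h2]
  refine hS.average_mem k l (h1.trans hn) fun y hy => ?_
  obtain ⟨i, -, rfl⟩ := (h3 y).1 hy
  exact hx i

/-- A vertex that is a positive convex combination of points is equal to all of them. -/
theorem eq_vertex_of_isPosComb {ι : Type*} [Fintype ι] {m : ℕ} {S : Set (Fin m → ℝ)}
    (hS : IsSubgroupoid S) {x : ι → Fin m → ℝ} {v : Fin m → ℝ} (hv : v ∈ vertices S)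
    (hx : ∀ i, x i ∈ S) (h : IsPosComb x v) (i : ι) : x i = v := by
  obtain ⟨c, hc, hc1, hcv⟩ := h
  have hvS : v ∈ S := hv.1 rfl
  -- Adjoining `v` itself makes `v` trivially a dyadic affine combination; weight `1 / 2` on it
  -- keeps all the others positive.
  let w : Option ι → Fin m → ℝ := fun o => o.elim v x
  have hw : ∀ o, w o ∈ S := by rintro (_ | i); exacts [hvS, hx i]
  have h1 : IsPosComb w v := by
    refine ⟨fun o => o.elim (1 / 2) fun i => 1 / 2 * c i, ?_, ?_, ?_⟩
    · rintro (_ | i)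
      · norm_num
      · have := hc i
        simpa using this
    · simp only [Fintype.sum_option, Option.elim, ← Finset.mul_sum, hc1]
      norm_num
    · simp only [w, Fintype.sum_option, Option.elim, mul_smul, ← Finset.smul_sum, hcv]
      rw [← add_smul]
      norm_num
  have h2 : IsDyadicAffineComb w v := by
    refine ⟨fun o => o.elim 1 fun _ => 0, ?_, ?_, ?_⟩
    · rintro (_ | i)
      exacts [one_mem _, zero_mem _]
    · simp
    · simp [w]
  obtain ⟨k, n, hn0, hn, hnv⟩ := h1.exists_nat (fun o => hS.1 (hw o)) h2
  obtain ⟨l, hl1, hl2, hl3⟩ := exists_list_of_multiplicities w n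
  refine eq_of_average_eq_vertex hS hv k l (hl1.trans hn) (fun y hy => ?_) (hl2 ▸ hnv) _
    ((hl3 _).2 ⟨some i, hn0 _, rfl⟩)
  obtain ⟨o, -, rfl⟩ := (hl3 y).1 hy
  exact hw o


/-! ### Noetherianity and finite generation -/

theorem coe_algebraMap_two_pow (k : ℕ) :
    (algebraMap ℤ dyadicRing (2 ^ k) : ℝ) = 2 ^ k := by
  rw [map_pow, Subring.coe_pow]
  rfl

instance : IsLocalization.Away (2 : ℤ) dyadicRing where
  map_units := by
    rintro ⟨_, k, rfl⟩
    refine IsUnit.of_mul_eq_one ⟨(1 : ℝ) / 2 ^ k, 1, k, by simp⟩ (Subtype.ext ?_)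
    change (algebraMap ℤ dyadicRing (2 ^ k) : ℝ) * (1 / 2 ^ k) = 1
    rw [coe_algebraMap_two_pow]
    field_simp
  surj := by
    rintro ⟨_, a, k, rfl⟩
    refine ⟨(a, ⟨2 ^ k, k, rfl⟩), Subtype.ext ?_⟩
    change (a : ℝ) / 2 ^ k * (algebraMap ℤ dyadicRing (2 ^ k) : ℝ) = a
    rw [coe_algebraMap_two_pow]
    field_simp
  exists_of_eq := by
    intro x y h
    refine ⟨1, ?_⟩
    have := congrArg Subtype.val h
    simpa using this

instance : IsNoetherianRing dyadicRing :=
  IsLocalization.isNoetherianRing (Submonoid.powers (2 : ℤ)) dyadicRing inferInstance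

/-- The affine dyadic hull of a set of dyadic points is spanned by finitely many of its points. -/
theorem exists_finset_isDyadicAffineComb {m : ℕ} {T : Set (Fin m → ℝ)} (hT : T ⊆ dyadicSpace m) :
    ∃ X : Finset (Fin m → ℝ), ↑X ⊆ T ∧
      ∀ p ∈ T, IsDyadicAffineComb (fun x : X => (x : Fin m → ℝ)) p := by
  classical
  -- Homogenization: a linear relation between lifted points is an affine one between the points.
  let h : (Fin m → ℝ) → Option (Fin m) → ℝ := fun x o => o.elim 1 x
  have hle : Submodule.span dyadicRing (h '' T) ≤
      Submodule.span dyadicRing (Set.range fun o : Option (Fin m) => Pi.single o (1 : ℝ)) := by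
    rw [Submodule.span_le]
    rintro _ ⟨x, hx, rfl⟩
    have hd : ∀ o, h x o ∈ dyadicRing := by
      rintro (_ | i)
      exacts [one_mem _, hT hx i]
    refine (Submodule.mem_span_range_iff_exists_fun _).2 ⟨fun o => ⟨h x o, hd o⟩, ?_⟩
    ext o
    simp [Finset.sum_apply, Subring.smul_def, Pi.single_apply]
  have hfg : (Submodule.span dyadicRing (h '' T)).FG :=
    Submodule.FG.of_le (Submodule.fg_span (Set.finite_range _)) hle
  obtain ⟨s, hs, hspan⟩ := (Submodule.fg_span_iff_fg_span_finset_subset _).1 hfg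
  obtain ⟨X, hX, rfl⟩ := Finset.subset_set_image_iff.1 hs
  refine ⟨X, hX, fun p hp => ?_⟩
  have hpm : h p ∈ Submodule.span dyadicRing (Set.range fun x : X => h x) := by
    have : Set.range (fun x : X => h x) = ↑(X.image h) := by
      ext y
      simp
    rw [this, ← hspan]
    exact Submodule.subset_span ⟨p, hp, rfl⟩
  obtain ⟨c, hc⟩ := (Submodule.mem_span_range_iff_exists_fun _).1 hpm
  refine ⟨fun x => c x, fun x => (c x).2, ?_, ?_⟩
  · simpa [h, Finset.sum_apply, Subring.smul_def] using congrFun hc none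
  · ext l
    simpa [h, Finset.sum_apply, Subring.smul_def] using congrFun hc (some l)

theorem IsDyadicAffineComb.sumElim {ι κ E : Type*} [Fintype ι] [Fintype κ] [AddCommGroup E]
    [Module ℝ E] (w : ι → E) {x : κ → E} {p : E} (h : IsDyadicAffineComb x p) :
    IsDyadicAffineComb (Sum.elim w x) p := by
  obtain ⟨c, hc, hc1, hcp⟩ := h
  refine ⟨Sum.elim 0 c, ?_, by simpa, by simpa⟩
  rintro (i | i)
  exacts [zero_mem _, hc i]

/-- Each `x k` receives weight `ε`, and `ε` times its expansion in `w` is subtracted. Those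
expansions have coefficients at most `1`, so the total removed from each `c i` is less than `δ`. -/
theorem IsPosComb.sumElim {ι κ E : Type*} [Fintype ι] [Fintype κ] [AddCommGroup E]
    [Module ℝ E] {w : ι → E} {x : κ → E} {p : E} (h : IsPosComb w p)
    (hx : ∀ k, IsPosComb w (x k)) : IsPosComb (Sum.elim w x) p := by
  obtain ⟨c, hc, hc1, hcp⟩ := h
  choose a ha ha1 hax using hx
  obtain ⟨δ, hδ, hδc⟩ := exists_pos_le c hc
  set ε : ℝ := δ / (Fintype.card κ + 1) with hε
  have hε0 : 0 < ε := by positivity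
  have ha_le : ∀ k i, a k i ≤ 1 := fun k i =>
    (ha1 k) ▸ Finset.single_le_sum (fun j _ => (ha k j).le) (Finset.mem_univ i)
  refine ⟨Sum.elim (fun i => c i - ε * ∑ k, a k i) fun _ => ε, ?_, ?_, ?_⟩
  · rintro (i | k)
    · have h1 : ∑ k, a k i ≤ Fintype.card κ := by
        simpa using Finset.sum_le_sum fun k (_ : k ∈ Finset.univ) => ha_le k i
      have h2 : ε * ∑ k, a k i < δ := by
        calc ε * ∑ k, a k i ≤ ε * Fintype.card κ := mul_le_mul_of_nonneg_left h1 hε0.le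
          _ < ε * (Fintype.card κ + 1) := by linarith
          _ = δ := by rw [hε]; field_simp
      have := hδc i
      simp only [Sum.elim_inl]
      linarith
    · exact hε0
  · simp only [Fintype.sum_sum_type, Sum.elim_inl, Sum.elim_inr, Finset.sum_sub_distrib, hc1,
      ← Finset.mul_sum]
    rw [Finset.sum_comm, Finset.sum_congr rfl fun k _ => ha1 k]
    simp [mul_comm]
  · simp only [Fintype.sum_sum_type, Sum.elim_inl, Sum.elim_inr, sub_smul, Finset.sum_sub_distrib,
      hcp, mul_smul, ← Finset.smul_sum, Finset.sum_smul]
    rw [Finset.sum_comm, Finset.sum_congr rfl fun k _ => hax k, sub_add_cancel]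

theorem exists_nonneg_of_mem_convexHull {ι E : Type*} [Fintype ι] [AddCommGroup E] [Module ℝ E]
    {x : ι → E} {p : E} (hp : p ∈ convexHull ℝ (Set.range x)) :
    ∃ c : ι → ℝ, (∀ i, 0 ≤ c i) ∧ ∑ i, c i = 1 ∧ ∑ i, c i • x i = p := by
  classical
  have := convexHull_basis_eq_stdSimplex (R := ℝ) (ι := ι)
  have h2 := (LinearMap.isLinear (Fintype.linearCombination ℝ x)).image_convexHull
    (Set.range fun i j : ι => if i = j then (1 : ℝ) else 0)
  rw [this, ← Set.range_comp] at h2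
  have h3 :
      (Fintype.linearCombination ℝ x ∘ fun i j : ι => if i = j then (1 : ℝ) else 0) = x := by
    ext1 i
    simp [Fintype.linearCombination_apply]
  rw [h3] at h2
  rw [← h2] at hp
  obtain ⟨c, ⟨h4, h5⟩, h6⟩ := hp
  exact ⟨c, h4, h5, by simpa [Fintype.linearCombination_apply] using h6⟩

theorem exists_isPosComb_of_mem_convexHull {ι E : Type*} [Fintype ι] [AddCommGroup E] [Module ℝ E]
    {x : ι → E} {p : E} (hp : p ∈ convexHull ℝ (Set.range x)) :
    ∃ W : Finset ι, IsPosComb (fun i : W => x i) p := by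
  classical
  obtain ⟨c, hc, hc1, hcp⟩ := exists_nonneg_of_mem_convexHull hp
  have hne : ∀ i, i ∉ Finset.univ.filter (fun i => 0 < c i) → c i = 0 := by
    intro i hi
    simp only [Finset.mem_filter, Finset.mem_univ, true_and, not_lt] at hi
    exact le_antisymm hi (hc i)
  refine ⟨Finset.univ.filter fun i => 0 < c i, fun i => c i, fun i => (Finset.mem_filter.1 i.2).2,
    ?_, ?_⟩
  · rw [Finset.sum_coe_sort _ fun i => c i, ← hc1]
    exact Finset.sum_subset (Finset.subset_univ _) fun i _ hi => hne i hi
  · rw [Finset.sum_coe_sort _ fun i => c i • x i, ← hcp]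
    exact Finset.sum_subset (Finset.subset_univ _) fun i _ hi => by rw [hne i hi, zero_smul]

theorem IsPosComb.mem_convexHull {ι E : Type*} [Fintype ι] [AddCommGroup E] [Module ℝ E]
    {x : ι → E} {p : E} (h : IsPosComb x p) : p ∈ convexHull ℝ (Set.range x) := by
  obtain ⟨c, hc, hc1, rfl⟩ := h
  exact (convex_convexHull ℝ _).sum_mem (fun i _ => (hc i).le) hc1
    fun i _ => subset_convexHull ℝ _ ⟨i, rfl⟩

theorem generated_subset {n : ℕ} {X E : Set (Fin n → ℝ)} (hE : IsSubgroupoid E) (hX : X ⊆ E) :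
    generated X ⊆ E :=
  Set.sInter_subset_of_mem ⟨hE, hX⟩

/-- A subgroupoid contained in the convex hull of finitely many of its points is finitely
generated. -/
theorem isFinitelyGenerated_of_subset_convexHull {m : ℕ} {S : Set (Fin m → ℝ)}
    (hS : IsSubgroupoid S) (V : Finset (Fin m → ℝ)) (hV : ↑V ⊆ S)
    (hSV : S ⊆ convexHull ℝ (V : Set (Fin m → ℝ))) : IsFinitelyGenerated S := by
  have key : ∀ W : Finset V, ∃ X : Finset (Fin m → ℝ), ↑X ⊆ S ∧ ∀ p ∈ S,
      IsPosComb (fun i : W => ((i : V) : Fin m → ℝ)) p →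
        ∀ E, IsSubgroupoid E → ↑V ⊆ E → ↑X ⊆ E → p ∈ E := by
    intro W
    obtain ⟨X, hX, h⟩ := exists_finset_isDyadicAffineComb
      (T := {p ∈ S | IsPosComb (fun i : W => ((i : V) : Fin m → ℝ)) p}) fun p hp => hS.1 hp.1
    refine ⟨X, fun x hx => (hX hx).1, fun p hp hpW E hE hVE hXE => ?_⟩
    refine hE.mem_of_isPosComb (x := Sum.elim (fun i : W => ((i : V) : Fin m → ℝ))
      fun x : X => (x : Fin m → ℝ)) ?_ (hpW.sumElim fun x => (hX x.2).2) ((h p ⟨hp, hpW⟩).sumElim _)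
    rintro (i | x)
    exacts [hVE i.1.2, hXE x.2]
  choose X hXS hX using key
  refine ⟨↑V ∪ ⋃ W, ↑(X W), V.finite_toSet.union (Set.finite_iUnion fun W => (X W).finite_toSet),
    Set.union_subset hV (Set.iUnion_subset hXS), Set.Subset.antisymm ?_ ?_⟩
  · exact generated_subset hS (Set.union_subset hV (Set.iUnion_subset hXS))
  · rintro p hp E ⟨hE, hXE⟩
    have hpV := hSV hp
    rw [show (V : Set (Fin m → ℝ)) = Set.range fun i : V => (i : Fin m → ℝ) by simp] at hpV
    obtain ⟨W, hW⟩ := exists_isPosComb_of_mem_convexHull hpV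
    exact hX W p hp hW E hE (Set.subset_union_left.trans hXE)
      ((Set.subset_iUnion (fun W => (X W : Set (Fin m → ℝ))) W).trans
        (Set.subset_union_right.trans hXE))

/-! ### Semipolytopes are finitely generated; transfer along isomorphisms -/

theorem extremePoints_subset_vertices {m : ℕ} (Q : Set (Fin m → ℝ)) :
    Q.extremePoints ℝ ∩ dyadicSpace m ⊆ vertices (Q ∩ dyadicSpace m) := by
  rintro v ⟨hv, hvd⟩
  rw [mem_extremePoints] at hv
  refine ⟨Set.singleton_subset_iff.2 ⟨hv.1, hvd⟩, fun a ha b hb => ⟨fun h => ?_, ?_⟩⟩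
  · refine hv.2 a ha.1 b hb.1 ⟨1 / 2, 1 / 2, by norm_num, by norm_num, by norm_num, ?_⟩
    rw [← smul_add]
    exact h
  · rintro ⟨rfl, rfl⟩
    rw [Set.mem_singleton_iff, mean, smul_add, ← add_smul]
    norm_num

theorem IsSemipolytope.isFinitelyGenerated {m : ℕ} {S : Set (Fin m → ℝ)} (h : IsSemipolytope S) :
    IsFinitelyGenerated S := by
  obtain ⟨hS, C, ⟨Q, ⟨V, hV, rfl⟩, hQ, rfl⟩, hSC, hvert, -⟩ := h
  have hfin : (Set.extremePoints ℝ (convexHull ℝ V)).Finite :=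
    hV.subset extremePoints_convexHull_subset
  refine isFinitelyGenerated_of_subset_convexHull hS hfin.toFinset ?_ ?_
  · rw [hfin.coe_toFinset]
    intro v hv
    have : v ∈ vertices S := hvert ▸ extremePoints_subset_vertices _ ⟨hv, hQ hv⟩
    exact this.1 rfl
  · rw [hfin.coe_toFinset]
    have := closure_convexHull_extremePoints (hV.isCompact_convexHull ℝ) (convex_convexHull ℝ V)
    rw [(hfin.isCompact_convexHull ℝ).isClosed.closure_eq] at this
    rw [this]
    exact hSC.trans Set.inter_subset_left

theorem Isomorphic.symm {m n : ℕ} {D : Set (Fin m → ℝ)} {E : Set (Fin n → ℝ)}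
    (hD : IsSubgroupoid D) (h : Isomorphic D E) : Isomorphic E D := by
  obtain ⟨e, he⟩ := h
  refine ⟨e.symm, fun x y z hz => ?_⟩
  let w : D := ⟨mean (e.symm x) (e.symm y), hD.2 _ (e.symm x).2 _ (e.symm y).2⟩
  have : e w = z := by
    refine Subtype.ext ?_
    rw [he (e.symm x) (e.symm y) w rfl, hz, e.apply_symm_apply, e.apply_symm_apply]
  rw [← this, e.symm_apply_apply]

theorem IsFinitelyGenerated.of_isomorphic {m n : ℕ} {D : Set (Fin m → ℝ)} {E : Set (Fin n → ℝ)}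
    (hD : IsSubgroupoid D) (hE : IsSubgroupoid E) (h : Isomorphic D E)
    (hfg : IsFinitelyGenerated D) : IsFinitelyGenerated E := by
  obtain ⟨e, he⟩ := h
  obtain ⟨X, hX, hXD, hgen⟩ := hfg
  have hYE : (fun x : D => (e x : Fin n → ℝ)) '' (Subtype.val ⁻¹' X) ⊆ E := by
    rintro _ ⟨x, -, rfl⟩
    exact (e x).2
  refine ⟨_, (hX.preimage Subtype.val_injective.injOn).image _, hYE,
    (generated_subset hE hYE).antisymm fun y hy F ⟨hF, hXF⟩ => ?_⟩
  -- The pullback of `F` along `e` contains the generators of `D`, hence all of `D`.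
  have hsub : IsSubgroupoid {x | ∃ h : x ∈ D, (e ⟨x, h⟩ : Fin n → ℝ) ∈ F} := by
    refine ⟨fun x hx => hD.1 hx.1, ?_⟩
    rintro x ⟨hx, hx'⟩ y ⟨hy, hy'⟩
    refine ⟨hD.2 x hx y hy, ?_⟩
    rw [he ⟨x, hx⟩ ⟨y, hy⟩ _ rfl]
    exact hF.2 _ hx' _ hy'
  have hDF := generated_subset hsub fun x hx => ⟨hXD hx, hXF ⟨⟨x, hXD hx⟩, hx, rfl⟩⟩
  rw [hgen] at hDF
  obtain ⟨h1, h2⟩ := hDF (e.symm ⟨y, hy⟩).2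
  simpa using h2


/-! ### Relative interior points and extreme points of the hull -/

theorem isPosComb_of_mem_intrinsicInterior {ι E : Type*} [Fintype ι] [AddCommGroup E] [Module ℝ E]
    [TopologicalSpace E] [IsTopologicalAddGroup E] [ContinuousSMul ℝ E] {x : ι → E} {p : E}
    (hp : p ∈ intrinsicInterior ℝ (convexHull ℝ (Set.range x))) : IsPosComb x p := by
  have hpQ := intrinsicInterior_subset hp
  have : Nonempty ι := by
    rw [← Set.range_nonempty_iff_nonempty (f := x), ← convexHull_nonempty_iff (𝕜 := ℝ)]
    exact ⟨p, hpQ⟩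
  set N : ℝ := (Fintype.card ι : ℝ) with hN
  have hN0 : 0 < N := by rw [hN]; exact_mod_cast Fintype.card_pos
  set g : E := ∑ i, (1 / N) • x i with hg
  have hN1 : ∑ _i : ι, 1 / N = 1 := by
    rw [Finset.sum_const, Finset.card_univ, nsmul_eq_mul, mul_one_div_cancel hN0.ne']
  have hgQ : g ∈ convexHull ℝ (Set.range x) :=
    IsPosComb.mem_convexHull ⟨fun _ => 1 / N, fun _ => by positivity, hN1, rfl⟩
  -- The segment from the barycentre `g` can be prolonged slightly beyond `p` within the hull. Then
  -- `p = (φ t + t • g) / (1 + t)`, and the share of `g` makes all coefficients positive.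
  let φ : ℝ → affineSpan ℝ (convexHull ℝ (Set.range x)) := fun t =>
    ⟨AffineMap.lineMap g p (1 + t), AffineMap.lineMap_mem _ (subset_affineSpan ℝ _ hgQ)
      (subset_affineSpan ℝ _ hpQ)⟩
  have hφ : Continuous φ := by
    refine Continuous.subtype_mk ?_ _
    simp only [AffineMap.lineMap_apply_module]
    fun_prop
  obtain ⟨y, hy, rfl⟩ := mem_intrinsicInterior.1 hp
  have h0 : φ 0 = y := Subtype.ext (by simp [φ])
  have hev : ∀ᶠ t in nhds (0 : ℝ), φ t ∈ (Subtype.val ⁻¹' convexHull ℝ (Set.range x) :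
      Set (affineSpan ℝ (convexHull ℝ (Set.range x)))) :=
    hφ.continuousAt.eventually (h0 ▸ mem_interior_iff_mem_nhds.1 hy)
  obtain ⟨t, htQ, ht⟩ := ((hev.filter_mono nhdsWithin_le_nhds).and
    (self_mem_nhdsWithin : Set.Ioi (0 : ℝ) ∈ nhdsWithin 0 (Set.Ioi 0))).exists
  replace ht : 0 < t := ht
  obtain ⟨a, ha, ha1, hat⟩ := exists_nonneg_of_mem_convexHull htQ
  refine ⟨fun i => (1 + t)⁻¹ * (a i + t * (1 / N)), fun i => ?_, ?_, ?_⟩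
  · have := ha i
    positivity
  · rw [← Finset.mul_sum, Finset.sum_add_distrib, ← Finset.mul_sum, ha1, hN1]
    field_simp
  · simp only [mul_smul, add_smul, ← Finset.smul_sum, Finset.sum_add_distrib, hat]
    rw [inv_smul_eq_iff₀ (by positivity), Finset.smul_sum, ← hg]
    simp only [φ, AffineMap.lineMap_apply_module]
    module

theorem IsPosComb.eq_of_forall_eq {ι E : Type*} [Fintype ι] [AddCommGroup E] [Module ℝ E]
    {x : ι → E} {p v : E} (h : IsPosComb x p) (hx : ∀ i, x i = v) : p = v := by
  obtain ⟨c, -, hc1, rfl⟩ := h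
  simp only [hx, ← Finset.sum_smul, hc1, one_smul]

/-- If a vertex lies strictly between real points `a` and `b` of the hull, their expansions combine
to a positive combination of points of `S`. By `eq_vertex_of_isPosComb` these points all equal the
vertex, hence so do `a` and `b`. -/
theorem vertices_eq_extremePoints {ι : Type*} [Fintype ι] {m : ℕ} {x : ι → Fin m → ℝ}
    {S : Set (Fin m → ℝ)} (hS : IsSubgroupoid S) (hxS : ∀ i, x i ∈ S)
    (hSx : S ⊆ convexHull ℝ (Set.range x)) :
    vertices S = (convexHull ℝ (Set.range x)).extremePoints ℝ := by
  refine Set.Subset.antisymm (fun v hv => ?_) fun v hv => ?_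
  · refine mem_extremePoints.2 ⟨hSx (hv.1 rfl), ?_⟩
    rintro a ha b hb ⟨s, t, hs, ht, hst, hv'⟩
    obtain ⟨W, hW⟩ := exists_isPosComb_of_mem_convexHull ha
    obtain ⟨U, hU⟩ := exists_isPosComb_of_mem_convexHull hb
    have hall := eq_vertex_of_isPosComb hS hv
      (x := Sum.elim (fun i : W => x i) fun i : U => x i)
      (by rintro (i | i) <;> exact hxS _) (by
        obtain ⟨c, hc, hc1, hcp⟩ := hW
        obtain ⟨d, hd, hd1, hdp⟩ := hU
        refine ⟨Sum.elim (fun i => s * c i) fun i => t * d i, ?_, ?_, ?_⟩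
        · rintro (i | i)
          exacts [mul_pos hs (hc i), mul_pos ht (hd i)]
        · simp only [Fintype.sum_sum_type, Sum.elim_inl, Sum.elim_inr, ← Finset.mul_sum, hc1, hd1,
            mul_one, hst]
        · simp only [Fintype.sum_sum_type, Sum.elim_inl, Sum.elim_inr, mul_smul,
            ← Finset.smul_sum, hcp, hdp, hv'])
    exact ⟨hW.eq_of_forall_eq fun i => hall (Sum.inl i), hU.eq_of_forall_eq fun i => hall (Sum.inr i)⟩
  · obtain ⟨i, rfl⟩ := extremePoints_convexHull_subset hv
    have h := extremePoints_subset_vertices _ ⟨hv, hS.1 (hxS i)⟩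
    exact ⟨Set.singleton_subset_iff.2 (hxS i), fun a ha b hb =>
      h.2 a ⟨hSx ha, hS.1 ha⟩ b ⟨hSx hb, hS.1 hb⟩⟩

theorem mean_mem_dyadicSpace {n : ℕ} {x y : Fin n → ℝ} (hx : x ∈ dyadicSpace n)
    (hy : y ∈ dyadicSpace n) : mean x y ∈ dyadicSpace n :=
  fun i => mul_mem half_mem_dyadicRing (add_mem (hx i) (hy i))

theorem mean_mem_convex {n : ℕ} {Q : Set (Fin n → ℝ)} (hQ : Convex ℝ Q) {x y : Fin n → ℝ}
    (hx : x ∈ Q) (hy : y ∈ Q) : mean x y ∈ Q := by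
  rw [mean, smul_add]
  exact hQ hx hy (by norm_num) (by norm_num) (by norm_num)

theorem affineSpan_subset_dyadicSpace {n : ℕ} {C : Set (Fin n → ℝ)} (hC : C ⊆ dyadicSpace n) :
    (affineSpan dyadicRing C : Set (Fin n → ℝ)) ⊆ dyadicSpace n := by
  intro p hp
  refine affineSpan_induction (p := fun x => x ∈ dyadicSpace n) hp (fun x hx => hC hx) ?_
  exact fun c u v w hu hv hw i => add_mem (mul_mem c.2 (sub_mem (hu i) (hv i))) (hw i)

/-- If a finite family spans `𝔻ᵐ` affinely over the dyadic rationals, then every subgroupoid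
between the family and its convex hull is a semipolytope. -/
theorem isSemipolytope_of_spanning_family {ι : Type*} [Fintype ι] {m : ℕ} {x : ι → Fin m → ℝ}
    (hx : ∀ p ∈ dyadicSpace m, IsDyadicAffineComb x p) {S : Set (Fin m → ℝ)}
    (hS : IsSubgroupoid S) (hxS : ∀ i, x i ∈ S) (hSx : S ⊆ convexHull ℝ (Set.range x)) :
    IsSemipolytope S := by
  set Q := convexHull ℝ (Set.range x) with hQ
  have hxC : Set.range x ⊆ Q ∩ dyadicSpace m := by
    rintro _ ⟨i, rfl⟩
    exact ⟨subset_convexHull ℝ _ ⟨i, rfl⟩, hS.1 (hxS i)⟩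
  have hC : IsSubgroupoid (Q ∩ dyadicSpace m) := ⟨Set.inter_subset_right, fun a ha b hb =>
    ⟨mean_mem_convex (convex_convexHull ℝ _) ha.1 hb.1, mean_mem_dyadicSpace ha.2 hb.2⟩⟩
  refine ⟨hS, Q ∩ dyadicSpace m, ⟨Q, ⟨_, Set.finite_range x, rfl⟩, ?_, rfl⟩,
    fun p hp => ⟨hSx hp, hS.1 hp⟩, ?_, Set.inter_eq_right.2 ?_⟩
  · exact extremePoints_convexHull_subset.trans (hxC.trans Set.inter_subset_right)
  · rw [vertices_eq_extremePoints hS hxS hSx,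
      vertices_eq_extremePoints hC (fun i => hxC ⟨i, rfl⟩) Set.inter_subset_left]
  · rintro p ⟨hp1, hp2⟩
    have hCQ : convexHull ℝ (Q ∩ dyadicSpace m) = Q :=
      (convexHull_min Set.inter_subset_left (convex_convexHull ℝ _)).antisymm
        (convexHull_mono hxC)
    rw [hCQ] at hp2
    exact hS.mem_of_isPosComb hxS (isPosComb_of_mem_intrinsicInterior hp2)
      (hx p (affineSpan_subset_dyadicSpace hC.1 hp1))

/-! ### Realizing a finitely generated groupoid as a semipolytope -/

theorem isSubgroupoid_empty {n : ℕ} : IsSubgroupoid (∅ : Set (Fin n → ℝ)) :=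
  ⟨Set.empty_subset _, fun _ h => h.elim⟩

theorem isSemipolytope_empty {m : ℕ} : IsSemipolytope (∅ : Set (Fin m → ℝ)) := by
  refine ⟨isSubgroupoid_empty, ∅, ⟨∅, ⟨∅, Set.finite_empty, by simp⟩, by simp, by simp⟩,
    subset_rfl, rfl, ?_⟩
  simp [relInterior]

/-- Coordinates on the affine dyadic hull of a finite family of dyadic points. -/
theorem exists_dyadic_coordinates {ι : Type*} [Fintype ι] {n : ℕ} (x : ι → Fin n → ℝ) (i₀ : ι) :
    ∃ (m : ℕ) (f : (Fin m → ℝ) → Fin n → ℝ) (x' : ι → Fin m → ℝ),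
      (∀ a b, f (mean a b) = mean (f a) (f b)) ∧ Set.InjOn f (dyadicSpace m) ∧
      (∀ i, x' i ∈ dyadicSpace m) ∧ (∀ i, f (x' i) = x i) ∧
      ∀ p ∈ dyadicSpace m, IsDyadicAffineComb x' p := by
  classical
  -- A `ℤ`-basis of this lattice stays independent over the dyadics, which gives injectivity on
  -- dyadic points.
  let L := Submodule.span ℤ (Set.range fun i => x i - x i₀)
  have : Module.Finite ℤ L := Module.Finite.span_of_finite ℤ (Set.finite_range _)
  let b := Module.finBasis ℤ L
  have hb : LinearIndependent ℤ (fun j => (b j : Fin n → ℝ)) :=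
    b.linearIndependent.map' L.subtype (Submodule.ker_subtype L)
  let y : ι → L := fun i => ⟨x i - x i₀, Submodule.subset_span ⟨i, rfl⟩⟩
  let r : L → Fin (Module.finrank ℤ L) → ℝ := fun u j => (b.repr u j : ℝ)
  refine ⟨Module.finrank ℤ L, fun d => x i₀ + ∑ j, d j • (b j : Fin n → ℝ), fun i => r (y i),
    ?_, ?_, fun i j => intCast_mem_dyadicRing _, fun i => ?_, fun p hp => ?_⟩
  · intro a c
    simp only [mean, Pi.smul_apply, Pi.add_apply, smul_eq_mul, mul_smul, add_smul,
      ← Finset.smul_sum, Finset.sum_add_distrib]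
    module
  · intro a ha c hc hac
    refine funext fun j => sub_eq_zero.1 (eq_zero_of_sum_dyadic_smul_eq_zero hb
      (d := fun j => a j - c j) (fun j => sub_mem (ha j) (hc j)) ?_ j)
    simp only [sub_smul, Finset.sum_sub_distrib]
    exact sub_eq_zero.2 (add_left_cancel hac)
  · have := congrArg L.subtype (b.sum_repr (y i))
    simp only [map_sum, map_smul, Submodule.subtype_apply] at this
    simp only [r, Int.cast_smul_eq_zsmul, this, y]
    abel
  · have hbj : ∀ j, ∃ a : ι → ℤ, ∑ i, a i • y i = b j := by
      intro j
      obtain ⟨a, ha⟩ := (Submodule.mem_span_range_iff_exists_fun ℤ).1 (b j).2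
      refine ⟨a, Subtype.ext ?_⟩
      simpa [y] using ha
    choose a ha using hbj
    have hr : ∀ j l, ∑ i, (a j i : ℝ) * r (y i) l = if j = l then 1 else 0 := by
      intro j l
      have h := congrArg (fun u => b.repr u l) (ha j)
      simp only [map_sum, map_smul, Finsupp.coe_finsetSum, Finset.sum_apply, Finsupp.smul_apply,
        smul_eq_mul, Module.Basis.repr_self, Finsupp.single_apply] at h
      simp only [r]
      exact_mod_cast h
    have hy0 : r (y i₀) = 0 := by
      have : y i₀ = 0 := Subtype.ext (sub_self _)
      ext l
      simp [r, this]
    let c : ι → ℝ := fun i => ∑ j, p j * a j i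
    have hc : ∀ i, c i ∈ dyadicRing := fun i =>
      sum_mem fun j _ => mul_mem (hp j) (intCast_mem_dyadicRing _)
    -- The base point has coordinates zero, so it absorbs the missing weight without moving the
    -- combination.
    refine ⟨fun i => c i + if i = i₀ then 1 - ∑ k, c k else 0, fun i => ?_, ?_, ?_⟩
    · refine add_mem (hc i) ?_
      split_ifs
      exacts [sub_mem (one_mem _) (sum_mem fun k _ => hc k), zero_mem _]
    · simp [Finset.sum_add_distrib]
    · simp only [add_smul, ite_smul, zero_smul, Finset.sum_add_distrib, Finset.sum_ite_eq',
        Finset.mem_univ, if_true, hy0, smul_zero, add_zero]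
      ext l
      simp only [Finset.sum_apply, Pi.smul_apply, smul_eq_mul, c, Finset.sum_mul]
      rw [Finset.sum_comm]
      simp only [mul_assoc, ← Finset.mul_sum, hr]
      simp

theorem IsFinitelyGenerated.exists_semipolytope {n : ℕ} {D : Set (Fin n → ℝ)}
    (hD : IsSubgroupoid D) (h : IsFinitelyGenerated D) :
    ∃ (m : ℕ) (S : Set (Fin m → ℝ)), IsSemipolytope S ∧ Isomorphic D S := by
  obtain ⟨X, hX, hXD, hgen⟩ := h
  rcases X.eq_empty_or_nonempty with rfl | ⟨x₀, hx₀⟩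
  · have : D = ∅ := by
      rw [← hgen]
      exact Set.subset_empty_iff.1 (generated_subset isSubgroupoid_empty subset_rfl)
    subst this
    exact ⟨n, ∅, isSemipolytope_empty, Equiv.refl _, fun _ _ _ h => h⟩
  have := hX.fintype
  obtain ⟨m, f, x', hf, hinj, hx', hfx, hspan⟩ :=
    exists_dyadic_coordinates (fun x : X => (x : Fin n → ℝ)) ⟨x₀, hx₀⟩
  set S : Set (Fin m → ℝ) := {d ∈ dyadicSpace m | f d ∈ D} with hSdef
  have hS : IsSubgroupoid S := ⟨fun d hd => hd.1, fun a ha c hc =>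
    ⟨mean_mem_dyadicSpace ha.1 hc.1, hf a c ▸ hD.2 _ ha.2 _ hc.2⟩⟩
  -- Preimages are found inside the hull; injectivity of `f` on dyadic points then confines all of
  -- `S` to it.
  have hsurj : ∀ y ∈ D, ∃ d ∈ dyadicSpace m, d ∈ convexHull ℝ (Set.range x') ∧ f d = y := by
    rw [← hgen]
    refine generated_subset (E := {y | y ∈ D ∧ ∃ d ∈ dyadicSpace m,
      d ∈ convexHull ℝ (Set.range x') ∧ f d = y}) ⟨fun y hy => hD.1 hy.1, ?_⟩ ?_ |>.trans
        fun y hy => hy.2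
    · rintro _ ⟨h1, d, hd, hd', rfl⟩ _ ⟨h2, e, he, he', rfl⟩
      exact ⟨hD.2 _ h1 _ h2, _, mean_mem_dyadicSpace hd he,
        mean_mem_convex (convex_convexHull ℝ _) hd' he', hf d e⟩
    · exact fun x hx => ⟨hXD hx, x' ⟨x, hx⟩, hx' _, subset_convexHull ℝ _ ⟨_, rfl⟩, hfx _⟩
  have hSx : S ⊆ convexHull ℝ (Set.range x') := by
    rintro d ⟨hd, hdD⟩
    obtain ⟨e, he, he', hed⟩ := hsurj _ hdD
    exact hinj he hd hed ▸ he'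
  refine ⟨m, S, isSemipolytope_of_spanning_family hspan hS
    (fun i => ⟨hx' i, (hfx i).symm ▸ hXD i.2⟩) hSx, Isomorphic.symm hS ?_⟩
  refine ⟨Equiv.ofBijective (fun d : S => (⟨f d, d.2.2⟩ : D)) ⟨?_, ?_⟩, ?_⟩
  · exact fun a c hac => Subtype.ext (hinj a.2.1 c.2.1 (congrArg Subtype.val hac))
  · rintro ⟨y, hy⟩
    obtain ⟨d, hd, -, rfl⟩ := hsurj y hy
    exact ⟨⟨d, hd, hy⟩, rfl⟩
  · intro a c d hd
    change f d = mean (f a) (f c)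
    rw [hd, hf]

end DyadicConvex

theorem theorem5p1 (n : ℕ) (D : Set (Fin n → ℝ)) (hD : DyadicConvex.IsSubgroupoid D) :
    DyadicConvex.IsFinitelyGenerated D ↔
      ∃ (m : ℕ) (S : Set (Fin m → ℝ)),
        DyadicConvex.IsSemipolytope S ∧ DyadicConvex.Isomorphic D S := by
  refine ⟨fun h => h.exists_semipolytope hD, ?_⟩
  rintro ⟨m, S, hS, h⟩
  exact hS.isFinitelyGenerated.of_isomorphic hS.1 hD (h.symm hD)
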